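/- Let $k$ be a perfect field of characteristic $p>0$ and let $K/k$ be a field extension, with perfect closure $K^{\mathrm{perf}}$. Let $\mathcal D_\infty(K/k)$ be the category of triples $(V,W,\psi)$, where $V$ is a finite-dimensional $K$-vector space, $W$ is a finite-dimensional $k$-vector space and $\psi\colon K^{\mathrm{perf}}\otimes_K V\to K^{\mathrm{perf}}\otimes_k W$ is a $K^{\mathrm{perf}}$-linear isomorphism; a morphism $(V,W,\psi)\to(V',W',\psi')$ is a pair $(a,b)$ of a $K$-linear map $a\colon V\to V'$ and a $k$-linear map $b\colon W\to W'$ with $\psi'\circ(\mathrm{id}\otimes a)=(\mathrm{id}\otimes b)\circ\psi$. With the evident tensor product and the fibre functor $\omega(V,W,\psi)=W$ it is a neutral $k$-Tannakian category. The local Nori fundamental group $\pi^{\mathrm L}(K/k)$ is its Tannakian group scheme, i.e. the affine group scheme over $k$ whose group of $R$-points, for a commutative $k$-algebra $R$, is the group $\mathrm{Aut}^{\otimes}(R\otimes_k\omega)$ of tensor automorphisms of $X\mapsto R\otimes_k\omega(X)$. Then $K$ is perfect if and only if $\pi^{\mathrm L}(K/k)$ is trivial. -/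

import Mathlib

open CategoryTheory
open scoped TensorProduct

universe u v w

/-- For a `k`-algebra `K` of characteristic `p`, the perfect closure of `K` is a `k`-algebra through
`k → K → K^perf`. The case `k = K` is the canonical `K`-algebra structure. -/
noncomputable instance PerfectClosure.instAlgebraTower (k : Type u) (K : Type v) [Field k] [Field K]
    [Algebra k K] (p : ℕ) [Fact p.Prime] [CharP K p] : Algebra k (PerfectClosure K p) :=
  ((PerfectClosure.of K p).comp (algebraMap k K)).toAlgebra

/-- An object `(V, W, ψ)` of the category `𝒟_∞(K/k)`. -/
structure LocalTriple (k : Type u) (K : Type v) [Field k] [Field K] [Algebra k K]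
    (p : ℕ) [Fact p.Prime] [CharP K p] where
  V : Type v
  W : Type u
  [addCommGroupV : AddCommGroup V]
  [moduleV : Module K V]
  [finiteV : FiniteDimensional K V]
  [addCommGroupW : AddCommGroup W]
  [moduleW : Module k W]
  [finiteW : FiniteDimensional k W]
  ψ : (PerfectClosure K p ⊗[K] V) ≃ₗ[PerfectClosure K p] (PerfectClosure K p ⊗[k] W)

namespace LocalTriple

attribute [instance] addCommGroupV moduleV finiteV addCommGroupW moduleW finiteW

section

variable {k : Type u} {K : Type v} [Field k] [Field K] [Algebra k K]
  {p : ℕ} [Fact p.Prime] [CharP K p]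

/-- A morphism of `𝒟_∞(K/k)`: a pair of linear maps compatible with the isomorphisms `ψ`. -/
@[ext]
structure Hom (X Y : LocalTriple k K p) where
  a : X.V →ₗ[K] Y.V
  b : X.W →ₗ[k] Y.W
  comm : Y.ψ.toLinearMap ∘ₗ a.baseChange (PerfectClosure K p) =
    b.baseChange (PerfectClosure K p) ∘ₗ X.ψ.toLinearMap

/-- The category `𝒟_∞(K/k)`. -/
instance : Category (LocalTriple k K p) where
  Hom X Y := Hom X Y
  id X := ⟨LinearMap.id, LinearMap.id, by simp⟩
  comp f g := ⟨g.a ∘ₗ f.a, g.b ∘ₗ f.b, by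
    rw [LinearMap.baseChange_comp, LinearMap.baseChange_comp, ← LinearMap.comp_assoc, g.comm,
      LinearMap.comp_assoc, f.comm, LinearMap.comp_assoc]⟩

/-- The unit object `(K, k, id)`. -/
noncomputable def unit (k : Type u) (K : Type v) [Field k] [Field K] [Algebra k K]
    (p : ℕ) [Fact p.Prime] [CharP K p] : LocalTriple k K p where
  V := K
  W := k
  ψ := (TensorProduct.AlgebraTensorModule.rid K (PerfectClosure K p) (PerfectClosure K p)).trans
    (TensorProduct.AlgebraTensorModule.rid k (PerfectClosure K p) (PerfectClosure K p)).symm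

/-- The tensor product `(V ⊗ V', W ⊗ W', ψ ⊗ ψ')`. -/
noncomputable def tensor (X Y : LocalTriple k K p) : LocalTriple k K p where
  V := X.V ⊗[K] Y.V
  W := X.W ⊗[k] Y.W
  ψ := (TensorProduct.AlgebraTensorModule.distribBaseChange K (PerfectClosure K p) X.V Y.V).trans
    ((TensorProduct.congr X.ψ Y.ψ).trans
      (TensorProduct.AlgebraTensorModule.distribBaseChange k (PerfectClosure K p) X.W Y.W).symm)

end

end LocalTriple

section

variable {k : Type u} {R S T : Type w} [Field k] [CommRing R] [Algebra k R]
  [CommRing S] [Algebra k S] [CommRing T] [Algebra k T] {W : Type u} [AddCommGroup W] [Module k W]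

/-- The base change along `f : R → S` of an endomorphism `e` of `R ⊗ W`: the `S`-linear endomorphism
of `S ⊗ W` that sends `1 ⊗ w` to the image of `e (1 ⊗ w)`. -/
noncomputable def pushEnd (f : R →ₐ[k] S) (e : (R ⊗[k] W) →ₗ[R] (R ⊗[k] W)) :
    (S ⊗[k] W) →ₗ[S] (S ⊗[k] W) :=
  LinearMap.liftBaseChange S
    (f.toLinearMap.rTensor W ∘ₗ e.restrictScalars k ∘ₗ TensorProduct.mk k R W 1)

theorem rTensor_smul_alg (f : R →ₐ[k] S) (r : R) (x : R ⊗[k] W) :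
    f.toLinearMap.rTensor W (r • x) = f r • f.toLinearMap.rTensor W x := by
  induction x with
  | zero => simp
  | tmul a w => simp [TensorProduct.smul_tmul']
  | add x y hx hy => rw [smul_add, map_add, map_add, hx, hy, smul_add]

theorem pushEnd_rTensor (f : R →ₐ[k] S) (e : (R ⊗[k] W) →ₗ[R] (R ⊗[k] W)) (x : R ⊗[k] W) :
    pushEnd f e (f.toLinearMap.rTensor W x) = f.toLinearMap.rTensor W (e x) := by
  induction x with
  | zero => simp
  | tmul a w =>
    have h : a ⊗ₜ[k] w = a • ((1 : R) ⊗ₜ[k] w) := by simp [TensorProduct.smul_tmul']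
    rw [h, rTensor_smul_alg, LinearMap.map_smul, LinearMap.map_smul, rTensor_smul_alg]
    congr 1
    simp [pushEnd]
  | add x y hx hy => simp only [map_add, hx, hy]

theorem pushEnd_unique (f : R →ₐ[k] S) {M : Type*} [AddCommMonoid M] [Module S M]
    (g h : (S ⊗[k] W) →ₗ[S] M)
    (H : ∀ x, g (f.toLinearMap.rTensor W x) = h (f.toLinearMap.rTensor W x)) : g = h := by
  refine LinearMap.ext fun z => ?_
  induction z with
  | zero => simp
  | tmul s w =>
    have h1 : s ⊗ₜ[k] w = s • f.toLinearMap.rTensor W ((1 : R) ⊗ₜ[k] w) := by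
      simp [TensorProduct.smul_tmul']
    rw [h1, map_smul, map_smul, H]
  | add x y hx hy => rw [map_add, map_add, hx, hy]

theorem pushEnd_comp (f : R →ₐ[k] S) (e e' : (R ⊗[k] W) →ₗ[R] (R ⊗[k] W)) :
    pushEnd f (e ∘ₗ e') = pushEnd f e ∘ₗ pushEnd f e' :=
  pushEnd_unique f _ _ fun x => by simp [pushEnd_rTensor]

theorem pushEnd_id (f : R →ₐ[k] S) :
    pushEnd f (LinearMap.id : (R ⊗[k] W) →ₗ[R] (R ⊗[k] W)) = LinearMap.id :=
  pushEnd_unique f _ _ fun x => by simp [pushEnd_rTensor]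

/-- Base change of an automorphism of `R ⊗ W` along `f : R → S`. -/
noncomputable def pushAut (f : R →ₐ[k] S) (e : (R ⊗[k] W) ≃ₗ[R] (R ⊗[k] W)) :
    (S ⊗[k] W) ≃ₗ[S] (S ⊗[k] W) :=
  LinearEquiv.ofLinearMap (pushEnd f e.toLinearMap) (pushEnd f e.symm.toLinearMap)
    (by rw [← pushEnd_comp, LinearEquiv.comp_symm, pushEnd_id])
    (by rw [← pushEnd_comp, LinearEquiv.symm_comp, pushEnd_id])

theorem pushAut_rTensor (f : R →ₐ[k] S) (e : (R ⊗[k] W) ≃ₗ[R] (R ⊗[k] W)) (x : R ⊗[k] W) :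
    pushAut f e (f.toLinearMap.rTensor W x) = f.toLinearMap.rTensor W (e x) :=
  pushEnd_rTensor f e.toLinearMap x

theorem pushAut_unique (f : R →ₐ[k] S) (g h : (S ⊗[k] W) ≃ₗ[S] (S ⊗[k] W))
    (H : ∀ x, g (f.toLinearMap.rTensor W x) = h (f.toLinearMap.rTensor W x)) : g = h :=
  LinearEquiv.toLinearMap_injective (pushEnd_unique f _ _ H)

theorem pushAut_idHom (e : (R ⊗[k] W) ≃ₗ[R] (R ⊗[k] W)) : pushAut (AlgHom.id k R) e = e := by
  refine pushAut_unique (AlgHom.id k R) _ _ fun y => ?_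
  have h : ∀ x : R ⊗[k] W, (AlgHom.id k R).toLinearMap.rTensor W x = x := fun x => by simp
  rw [pushAut_rTensor, h, h]

theorem pushAut_compHom (f : R →ₐ[k] S) (g : S →ₐ[k] T) (e : (R ⊗[k] W) ≃ₗ[R] (R ⊗[k] W)) :
    pushAut (g.comp f) e = pushAut g (pushAut f e) := by
  refine pushAut_unique (g.comp f) _ _ fun y => ?_
  have h : ∀ x : R ⊗[k] W, (g.comp f).toLinearMap.rTensor W x =
      g.toLinearMap.rTensor W (f.toLinearMap.rTensor W x) := fun x => by
    rw [← LinearMap.rTensor_comp_apply]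
    rfl
  rw [pushAut_rTensor, h, h, pushAut_rTensor, pushAut_rTensor]

end

section

variable {k : Type u} {R S : Type w} [Field k] [CommRing R] [Algebra k R]
  [CommRing S] [Algebra k S] {W W' : Type u} [AddCommGroup W] [Module k W]
  [AddCommGroup W'] [Module k W']

theorem rTensor_baseChange (f : R →ₐ[k] S) (b : W →ₗ[k] W') (x : R ⊗[k] W) :
    f.toLinearMap.rTensor W' (b.baseChange R x) = b.baseChange S (f.toLinearMap.rTensor W x) := by
  induction x with
  | zero => simp
  | tmul a w => simp
  | add x y hx hy => simp only [map_add, hx, hy]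

theorem rTensor_distrib_symm (f : R →ₐ[k] S) (x : R ⊗[k] W) (y : R ⊗[k] W') :
    f.toLinearMap.rTensor (W ⊗[k] W')
        ((TensorProduct.AlgebraTensorModule.distribBaseChange k R W W').symm (x ⊗ₜ[R] y)) =
      (TensorProduct.AlgebraTensorModule.distribBaseChange k S W W').symm
        (f.toLinearMap.rTensor W x ⊗ₜ[S] f.toLinearMap.rTensor W' y) := by
  induction x with
  | zero => simp
  | add x x' hx hx' => simp only [TensorProduct.add_tmul, map_add, hx, hx']
  | tmul a w =>
    induction y with
    | zero => simp
    | add y y' hy hy' => simp only [TensorProduct.tmul_add, map_add, hy, hy']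
    | tmul b w' =>
      simp [TensorProduct.AlgebraTensorModule.distribBaseChange, TensorProduct.smul_tmul']

theorem congr_pushAut (f : R →ₐ[k] S) (e : (R ⊗[k] W) ≃ₗ[R] (R ⊗[k] W))
    (e' : (R ⊗[k] W') ≃ₗ[R] (R ⊗[k] W'))
    (E : (R ⊗[k] (W ⊗[k] W')) ≃ₗ[R] (R ⊗[k] (W ⊗[k] W')))
    (h : ∀ z, TensorProduct.AlgebraTensorModule.distribBaseChange k R W W' (E z) =
      TensorProduct.congr e e' (TensorProduct.AlgebraTensorModule.distribBaseChange k R W W' z))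
    (z : S ⊗[k] (W ⊗[k] W')) :
    TensorProduct.AlgebraTensorModule.distribBaseChange k S W W' (pushAut f E z) =
      TensorProduct.congr (pushAut f e) (pushAut f e')
        (TensorProduct.AlgebraTensorModule.distribBaseChange k S W W' z) := by
  set DR := TensorProduct.AlgebraTensorModule.distribBaseChange k R W W'
  set DS := TensorProduct.AlgebraTensorModule.distribBaseChange k S W W'
  have key : DS.toLinearMap ∘ₗ (pushAut f E).toLinearMap =
      (TensorProduct.congr (pushAut f e) (pushAut f e')).toLinearMap ∘ₗ DS.toLinearMap := by
    apply pushEnd_unique f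
    intro x
    obtain ⟨t, rfl⟩ := DR.symm.surjective x
    simp only [LinearMap.comp_apply, LinearEquiv.coe_coe, pushAut_rTensor]
    have hE : E (DR.symm t) = DR.symm (TensorProduct.congr e e' t) := by
      apply DR.injective
      rw [h, DR.apply_symm_apply, DR.apply_symm_apply]
    rw [hE]
    clear hE
    induction t with
    | zero => simp
    | add t t' ht ht' => simp only [map_add, ht, ht']
    | tmul x y =>
      rw [TensorProduct.congr_tmul, rTensor_distrib_symm, rTensor_distrib_symm,
        LinearEquiv.apply_symm_apply, LinearEquiv.apply_symm_apply, TensorProduct.congr_tmul,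
        pushAut_rTensor, pushAut_rTensor]
  exact LinearMap.congr_fun key z

end

/-- `π^L(K/k)(R) = Aut^⊗(ω ⊗ R)`: the group of families `λ_X` of `R`-linear automorphisms of
`R ⊗ ω(X)`, where `ω(V, W, ψ) = W`, that are natural in `X`, compatible with tensor products and
the identity on the unit object. -/
noncomputable def localNoriPoints (k : Type u) (K : Type v) [Field k] [Field K] [Algebra k K]
    (p : ℕ) [Fact p.Prime] [CharP K p] (R : Type w) [CommRing R] [Algebra k R] :
    Subgroup (∀ X : LocalTriple k K p, (R ⊗[k] X.W) ≃ₗ[R] (R ⊗[k] X.W)) where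
  carrier := {l |
    (∀ (X Y : LocalTriple k K p) (f : X ⟶ Y) (x : R ⊗[k] X.W),
      f.b.baseChange R (l X x) = l Y (f.b.baseChange R x)) ∧
    (∀ (X Y : LocalTriple k K p) (z : R ⊗[k] (X.W ⊗[k] Y.W)),
      TensorProduct.AlgebraTensorModule.distribBaseChange k R X.W Y.W (l (X.tensor Y) z) =
        TensorProduct.congr (l X) (l Y)
          (TensorProduct.AlgebraTensorModule.distribBaseChange k R X.W Y.W z)) ∧
    l (LocalTriple.unit k K p) = 1}
  mul_mem' := by
    rintro a b ⟨ha, ha', ha''⟩ ⟨hb, hb', hb''⟩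
    refine ⟨fun X Y f x => ?_, fun X Y z => ?_, ?_⟩
    · simp only [Pi.mul_apply, LinearEquiv.mul_apply, ha, hb]
    · refine (ha' X Y (b (X.tensor Y) z)).trans ?_
      rw [hb', Pi.mul_apply, Pi.mul_apply, LinearEquiv.mul_eq_trans, LinearEquiv.mul_eq_trans,
        TensorProduct.congr_trans]
      rfl
    · rw [Pi.mul_apply, ha'', hb'', mul_one]
  one_mem' := by
    refine ⟨fun X Y f x => rfl, fun X Y z => ?_, rfl⟩
    simp only [Pi.one_apply, LinearEquiv.one_eq_refl, TensorProduct.congr_refl_refl]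
    rfl
  inv_mem' := by
    rintro a ⟨ha, ha', ha''⟩
    refine ⟨fun X Y f x => ?_, fun X Y z => ?_, ?_⟩
    · apply (a Y).injective
      rw [← ha]
      exact (congrArg _ ((a X).apply_symm_apply x)).trans ((a Y).apply_symm_apply _).symm
    · apply (TensorProduct.congr (a X) (a Y)).injective
      refine (ha' X Y _).symm.trans ?_
      refine (congrArg _ ((a (X.tensor Y)).apply_symm_apply z)).trans ?_
      exact ((TensorProduct.congr (a X) (a Y)).apply_symm_apply _).symm
    · rw [Pi.inv_apply, ha'', inv_one]

/-- The local Nori fundamental group `π^L(K/k)`, the Tannakian group scheme of `𝒟_∞(K/k)` with the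
fibre functor `ω(V, W, ψ) = W`, given by its functor of points `R ↦ Aut^⊗(ω ⊗ R)` on
`k`-algebras. -/
noncomputable def localNoriGroup (k : Type u) (K : Type v) [Field k] [Field K] [Algebra k K]
    (p : ℕ) [Fact p.Prime] [CharP K p] :
    CommAlgCat.{max u v} k ⥤ GrpCat.{max (u + 1) (v + 1)} where
  obj R := GrpCat.of (localNoriPoints k K p R)
  map {R S} f := GrpCat.ofHom
    { toFun := fun l => ⟨fun X => pushAut f.hom (l.1 X), by
        obtain ⟨l, h, h', h''⟩ := l
        refine ⟨fun X Y g x => ?_, fun X Y z => ?_, ?_⟩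
        · refine LinearMap.congr_fun (pushEnd_unique f.hom
            (g.b.baseChange S ∘ₗ (pushAut f.hom (l X)).toLinearMap)
            ((pushAut f.hom (l Y)).toLinearMap ∘ₗ g.b.baseChange S) fun y => ?_) x
          simp only [LinearMap.comp_apply, LinearEquiv.coe_coe, pushAut_rTensor,
            ← rTensor_baseChange, h]
        · exact congr_pushAut f.hom (l X) (l Y) (l (X.tensor Y)) (h' X Y) z
        · refine pushAut_unique f.hom _ _ fun y => ?_
          simp only [pushAut_rTensor, h'']
          rfl⟩
      map_one' := Subtype.ext <| funext fun X => pushAut_unique f.hom _ _ fun y => by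
        rw [pushAut_rTensor]
        rfl
      map_mul' := fun a b => Subtype.ext <| funext fun X => pushAut_unique f.hom _ _ fun y => by
        rw [pushAut_rTensor]
        refine Eq.trans ?_ (congrArg _ (pushAut_rTensor f.hom (b.1 X) y)).symm
        exact (pushAut_rTensor f.hom (a.1 X) (b.1 X y)).symm }
  map_id R := GrpCat.hom_ext <| MonoidHom.ext fun l => Subtype.ext <| funext fun X =>
    pushAut_idHom (l.1 X)
  map_comp f g := GrpCat.hom_ext <| MonoidHom.ext fun l => Subtype.ext <| funext fun X =>
    pushAut_compHom f.hom g.hom (l.1 X)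

/-!
A `K`-algebra map `f : K^perf → R` turns each `ψ` into an isomorphism `f_* ψ : R ⊗_K V ≃ R ⊗_k W`,
compatibly with morphisms and tensor products. Two such maps `f, g` therefore give the point
`g_* ψ ∘ (f_* ψ)⁻¹` of `π^L(K/k)(R)`, which on the object `(K, k, t)` is multiplication by
`g t / f t`. If `π^L(K/k)` is trivial, take for `f, g` the two inclusions of `K^perf` into
`K^perf ⊗_K K^perf`: then `t ⊗ 1 = 1 ⊗ t` for every `t`, and faithfully flat descent gives
`K = K^perf`. Conversely, if `K = K^perf`, then every `1 ⊗ w` is `ψ (1 ⊗ v)` for some `v : V`, so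
`w` lies in the image of a morphism from the unit object, on which every point acts trivially.
-/

section PerfectClosure

variable {K : Type v} [Field K] {p : ℕ} [Fact p.Prime] [CharP K p]

theorem perfectField_iff_surjective_algebraMap_perfectClosure :
    PerfectField K ↔ Function.Surjective (algebraMap K (PerfectClosure K p)) := by
  constructor
  · intro _
    have : IsPRadical (algebraMap K (PerfectClosure K p)) p := PerfectClosure.isPRadical K p
    have := IsPRadical.isPurelyInseparable K (PerfectClosure K p) p
    exact IsPurelyInseparable.surjective_algebraMap_of_isSeparable K (PerfectClosure K p)
  · intro h
    exact PerfectField.of_ringEquiv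
      (RingEquiv.ofBijective _ ⟨(algebraMap K (PerfectClosure K p)).injective, h⟩).symm

end PerfectClosure

theorem surjective_algebraMap_of_includeLeft_eq_includeRight {A B : Type*} [CommRing A] [CommRing B]
    [Algebra A B] [Module.FaithfullyFlat A B]
    (h : (Algebra.TensorProduct.includeLeft : B →ₐ[A] B ⊗[A] B) =
      Algebra.TensorProduct.includeRight) :
    Function.Surjective (algebraMap A B) := fun b => by
  change b ∈ Set.range (algebraMap A B)
  rw [← (Algebra.IsEffective.of_faithfullyFlat A B).eqLocus_includeLeft_includeRight]
  exact DFunLike.congr_fun h b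

section BaseChange

open TensorProduct

variable {k K E R : Type*} [CommRing k] [CommRing K] [CommRing E] [CommRing R]
  [Algebra k E] [Algebra k R] [Algebra K E] [Algebra K R]
  {V V' W W' : Type*} [AddCommGroup V] [Module K V] [AddCommGroup V'] [Module K V']
  [AddCommGroup W] [Module k W] [AddCommGroup W'] [Module k W']

/-- The map `f ⊗ id : E ⊗ W → R ⊗ W`, bundled as an `f`-semilinear map so that it can be fed to
`TensorProduct.map` over the two different base rings `E` and `R`. -/
noncomputable def semilinearRTensor (f : E →ₐ[k] R) (W : Type*) [AddCommGroup W] [Module k W] :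
    E ⊗[k] W →ₛₗ[(f : E →+* R)] R ⊗[k] W where
  __ := f.toLinearMap.rTensor W
  map_smul' a x := by
    simp only [AddHom.toFun_eq_coe, LinearMap.coe_toAddHom, RingHom.coe_coe]
    induction x with
    | zero => simp
    | tmul e w => simp [smul_tmul']
    | add x y hx hy => simp only [smul_add, map_add, hx, hy]

@[simp]
theorem semilinearRTensor_tmul (f : E →ₐ[k] R) (e : E) (w : W) :
    semilinearRTensor f W (e ⊗ₜ w) = f e ⊗ₜ w :=
  rfl

theorem baseChange_semilinearRTensor (f : E →ₐ[k] R) (b : W →ₗ[k] W') (x : E ⊗[k] W) :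
    b.baseChange R (semilinearRTensor f W x) = semilinearRTensor f W' (b.baseChange E x) := by
  induction x with
  | zero => simp only [map_zero]
  | tmul e w => rfl
  | add x y hx hy => simp only [map_add, hx, hy]

theorem distribBaseChange_semilinearRTensor (f : E →ₐ[k] R) (x : E ⊗[k] (W ⊗[k] W')) :
    AlgebraTensorModule.distribBaseChange k R W W' (semilinearRTensor f (W ⊗[k] W') x) =
      TensorProduct.map (semilinearRTensor f W) (semilinearRTensor f W')
        (AlgebraTensorModule.distribBaseChange k E W W' x) := by
  induction x with
  | zero => simp only [map_zero]
  | add x y hx hy => simp only [map_add, hx, hy]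
  | tmul e z =>
    induction z with
    | zero => simp only [tmul_zero, map_zero]
    | add x y hx hy => simp only [tmul_add, map_add, hx, hy]
    | tmul w w' => simp

theorem linearMap_ext_one_tmul {M : Type*} [AddCommMonoid M] [Module R M]
    {g h : (R ⊗[K] V) →ₗ[R] M} (H : ∀ v : V, g (1 ⊗ₜ v) = h (1 ⊗ₜ v)) : g = h :=
  (TensorProduct.isBaseChange K V R).algHom_ext g h H

variable [Algebra k K] [IsScalarTower k K E] [IsScalarTower k K R]

/-- The base change along `f : E → R` of a comparison isomorphism `ψ : E ⊗ V ≃ E ⊗ W`. The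
`E`-algebra structure that `f` puts on `R` stays inside the definition, so that several `f` can be
used for the same `R`. -/
noncomputable def pushIso (f : E →ₐ[K] R) (ψ : (E ⊗[K] V) ≃ₗ[E] (E ⊗[k] W)) :
    (R ⊗[K] V) ≃ₗ[R] (R ⊗[k] W) :=
  letI := f.toRingHom.toAlgebra
  haveI : IsScalarTower K E R := IsScalarTower.of_algebraMap_eq' f.comp_algebraMap.symm
  haveI : IsScalarTower k E R :=
    IsScalarTower.of_algebraMap_eq' (f.restrictScalars k).comp_algebraMap.symm
  (AlgebraTensorModule.cancelBaseChange K E R R V).symm ≪≫ₗ ψ.baseChange E R _ _ ≪≫ₗ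
    AlgebraTensorModule.cancelBaseChange k E R R W

theorem pushIso_one_tmul (f : E →ₐ[K] R) (ψ : (E ⊗[K] V) ≃ₗ[E] (E ⊗[k] W)) (v : V) :
    pushIso f ψ (1 ⊗ₜ v) = semilinearRTensor (f.restrictScalars k) W (ψ (1 ⊗ₜ v)) := by
  let _ := f.toRingHom.toAlgebra
  have : IsScalarTower K E R := IsScalarTower.of_algebraMap_eq' f.comp_algebraMap.symm
  have : IsScalarTower k E R :=
    IsScalarTower.of_algebraMap_eq' (f.restrictScalars k).comp_algebraMap.symm
  have cancel_one_tmul (y : E ⊗[k] W) : AlgebraTensorModule.cancelBaseChange k E R R W (1 ⊗ₜ y) =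
      semilinearRTensor (f.restrictScalars k) W y := by
    induction y with
    | zero => simp only [tmul_zero, map_zero]
    | tmul e w =>
      rw [AlgebraTensorModule.cancelBaseChange_tmul, Algebra.smul_def, mul_one]
      rfl
    | add x y hx hy => simp only [tmul_add, map_add, hx, hy]
  exact cancel_one_tmul (ψ (1 ⊗ₜ v))

theorem baseChange_pushIso (f : E →ₐ[K] R) {ψ : (E ⊗[K] V) ≃ₗ[E] (E ⊗[k] W)}
    {ψ' : (E ⊗[K] V') ≃ₗ[E] (E ⊗[k] W')} {a : V →ₗ[K] V'} {b : W →ₗ[k] W'}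
    (h : ψ'.toLinearMap ∘ₗ a.baseChange E = b.baseChange E ∘ₗ ψ.toLinearMap) (x : R ⊗[K] V) :
    b.baseChange R (pushIso f ψ x) = pushIso f ψ' (a.baseChange R x) := by
  suffices b.baseChange R ∘ₗ (pushIso f ψ).toLinearMap =
      (pushIso f ψ').toLinearMap ∘ₗ a.baseChange R from LinearMap.congr_fun this x
  refine linearMap_ext_one_tmul fun v => ?_
  have hv : ψ' (1 ⊗ₜ a v) = b.baseChange E (ψ (1 ⊗ₜ v)) := LinearMap.congr_fun h (1 ⊗ₜ v)
  simp only [LinearMap.comp_apply, LinearEquiv.coe_coe, LinearMap.baseChange_tmul,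
    pushIso_one_tmul, hv, baseChange_semilinearRTensor]

/-- The tensor product of two comparison isomorphisms; on objects of `𝒟_∞(K/k)` it is the `ψ` of
`LocalTriple.tensor`. -/
noncomputable def tensorIso (ψ : (E ⊗[K] V) ≃ₗ[E] (E ⊗[k] W))
    (ψ' : (E ⊗[K] V') ≃ₗ[E] (E ⊗[k] W')) : (E ⊗[K] (V ⊗[K] V')) ≃ₗ[E] (E ⊗[k] (W ⊗[k] W')) :=
  (AlgebraTensorModule.distribBaseChange K E V V').trans
    ((TensorProduct.congr ψ ψ').trans (AlgebraTensorModule.distribBaseChange k E W W').symm)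

theorem pushIso_tensorIso (f : E →ₐ[K] R) (ψ : (E ⊗[K] V) ≃ₗ[E] (E ⊗[k] W))
    (ψ' : (E ⊗[K] V') ≃ₗ[E] (E ⊗[k] W')) :
    pushIso f (tensorIso ψ ψ') = tensorIso (pushIso f ψ) (pushIso f ψ') := by
  refine LinearEquiv.toLinearMap_injective (linearMap_ext_one_tmul fun t => ?_)
  induction t with
  | zero => simp only [tmul_zero, map_zero]
  | add t t' ht ht' => simp only [tmul_add, map_add, ht, ht']
  | tmul v v' =>
    apply (AlgebraTensorModule.distribBaseChange k R W W').injective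
    simp only [tensorIso, LinearEquiv.coe_coe, LinearEquiv.trans_apply, pushIso_one_tmul,
      distribBaseChange_semilinearRTensor, LinearEquiv.apply_symm_apply,
      AlgebraTensorModule.distribBaseChange_tmul, congr_tmul, map_tmul]

/-- The comparison isomorphism `E ⊗ K ≃ E ≃ E ⊗ k` of the unit object, over any ring `E`. -/
noncomputable def unitIso (k K E : Type*) [CommRing k] [CommRing K] [CommRing E] [Algebra k E]
    [Algebra K E] : (E ⊗[K] K) ≃ₗ[E] (E ⊗[k] k) :=
  (AlgebraTensorModule.rid K E E).trans (AlgebraTensorModule.rid k E E).symm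

theorem pushIso_unitIso (f : E →ₐ[K] R) : pushIso f (unitIso k K E) = unitIso k K R := by
  refine LinearEquiv.toLinearMap_injective (linearMap_ext_one_tmul fun c => ?_)
  simp only [LinearEquiv.coe_coe, pushIso_one_tmul, unitIso, LinearEquiv.trans_apply,
    AlgebraTensorModule.rid_tmul, AlgebraTensorModule.rid_symm_apply,
    ← Algebra.algebraMap_eq_smul_one]
  exact congrArg (· ⊗ₜ[k] (1 : k)) (f.commutes c)

theorem pushIso_smulOfUnit (f : E →ₐ[K] R) (ψ : (E ⊗[K] V) ≃ₗ[E] (E ⊗[k] W)) (t : Eˣ) :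
    pushIso f (ψ ≪≫ₗ LinearEquiv.smulOfUnit t) =
      pushIso f ψ ≪≫ₗ LinearEquiv.smulOfUnit (Units.map (f : E →* R) t) := by
  refine LinearEquiv.toLinearMap_injective (linearMap_ext_one_tmul fun v => ?_)
  simp only [LinearEquiv.coe_coe, LinearEquiv.trans_apply, pushIso_one_tmul]
  exact LinearMap.map_smulₛₗ (semilinearRTensor (f.restrictScalars k) W) (t : E) (ψ (1 ⊗ₜ v))

/-- The automorphism of `R ⊗ W` measuring the difference between the base changes of `ψ` along `f`
and along `g`. -/
noncomputable def comparison (f g : E →ₐ[K] R) (ψ : (E ⊗[K] V) ≃ₗ[E] (E ⊗[k] W)) :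
    (R ⊗[k] W) ≃ₗ[R] (R ⊗[k] W) :=
  (pushIso f ψ).symm ≪≫ₗ pushIso g ψ

@[simp]
theorem comparison_pushIso (f g : E →ₐ[K] R) (ψ : (E ⊗[K] V) ≃ₗ[E] (E ⊗[k] W)) (x : R ⊗[K] V) :
    comparison f g ψ (pushIso f ψ x) = pushIso g ψ x := by
  rw [comparison, LinearEquiv.trans_apply, LinearEquiv.symm_apply_apply]

theorem baseChange_comparison (f g : E →ₐ[K] R) {ψ : (E ⊗[K] V) ≃ₗ[E] (E ⊗[k] W)}
    {ψ' : (E ⊗[K] V') ≃ₗ[E] (E ⊗[k] W')} {a : V →ₗ[K] V'} {b : W →ₗ[k] W'}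
    (h : ψ'.toLinearMap ∘ₗ a.baseChange E = b.baseChange E ∘ₗ ψ.toLinearMap) (x : R ⊗[k] W) :
    b.baseChange R (comparison f g ψ x) = comparison f g ψ' (b.baseChange R x) := by
  obtain ⟨x, rfl⟩ := (pushIso f ψ).surjective x
  rw [comparison_pushIso, baseChange_pushIso g h, baseChange_pushIso f h, comparison_pushIso]

theorem distribBaseChange_comparison_tensorIso (f g : E →ₐ[K] R)
    (ψ : (E ⊗[K] V) ≃ₗ[E] (E ⊗[k] W)) (ψ' : (E ⊗[K] V') ≃ₗ[E] (E ⊗[k] W'))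
    (z : R ⊗[k] (W ⊗[k] W')) :
    AlgebraTensorModule.distribBaseChange k R W W' (comparison f g (tensorIso ψ ψ') z) =
      TensorProduct.congr (comparison f g ψ) (comparison f g ψ')
        (AlgebraTensorModule.distribBaseChange k R W W' z) := by
  rw [comparison, pushIso_tensorIso, pushIso_tensorIso]
  simp only [comparison, tensorIso, LinearEquiv.trans_symm,
    LinearEquiv.symm_symm, LinearEquiv.trans_apply, LinearEquiv.apply_symm_apply,
    TensorProduct.congr_trans, TensorProduct.congr_symm]

theorem comparison_unitIso (f g : E →ₐ[K] R) : comparison f g (unitIso k K E) = 1 := by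
  rw [comparison, pushIso_unitIso, pushIso_unitIso, LinearEquiv.symm_trans_self]
  rfl

theorem comparison_smulOfUnit (f g : E →ₐ[K] R) (ψ : (E ⊗[K] V) ≃ₗ[E] (E ⊗[k] W)) (t : Eˣ)
    (x : R ⊗[k] W) :
    comparison f g (ψ ≪≫ₗ LinearEquiv.smulOfUnit t) (f t • x) = g t • comparison f g ψ x := by
  obtain ⟨x, rfl⟩ := (pushIso f ψ).surjective x
  rw [comparison_pushIso]
  have h (f : E →ₐ[K] R) : pushIso f (ψ ≪≫ₗ LinearEquiv.smulOfUnit t) x = f t • pushIso f ψ x := by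
    rw [pushIso_smulOfUnit]
    rfl
  rw [← h, comparison_pushIso, h]

end BaseChange

section LocalNori

variable {k : Type u} {K : Type v} [Field k] [Field K] [Algebra k K]
  {p : ℕ} [Fact p.Prime] [CharP K p]

namespace LocalTriple

instance : IsScalarTower k K (PerfectClosure K p) := IsScalarTower.of_algebraMap_eq' rfl

/-- The morphism `(K, k, id) ⟶ (V, W, ψ)` given by `v : V` and `w : W` with `ψ (1 ⊗ v) = 1 ⊗ w`. -/
noncomputable def homOfUnit {X : LocalTriple k K p} {v : X.V} {w : X.W}
    (h : X.ψ (1 ⊗ₜ v) = 1 ⊗ₜ w) : unit k K p ⟶ X where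
  a := LinearMap.toSpanSingleton K X.V v
  b := LinearMap.toSpanSingleton k X.W w
  comm := by
    refine linearMap_ext_one_tmul (V := K) fun c => ?_
    change X.ψ ((1 : PerfectClosure K p) ⊗ₜ[K] (c • v)) =
      (LinearMap.toSpanSingleton k X.W w).baseChange _ (unitIso k K _ (1 ⊗ₜ c))
    rw [TensorProduct.tmul_smul, ← algebraMap_smul (PerfectClosure K p) c, map_smul, h]
    simp [unitIso, TensorProduct.smul_tmul', Algebra.smul_def]

/-- The object `(V, W, t ψ)`; the twists of the unit object are the rank-one objects that detect
the values of maps out of `K^perf`. -/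
noncomputable def twist (X : LocalTriple k K p) (t : (PerfectClosure K p)ˣ) :
    LocalTriple k K p :=
  { X with ψ := X.ψ ≪≫ₗ LinearEquiv.smulOfUnit t }

end LocalTriple

variable {R : Type w} [CommRing R] [Algebra k R]

theorem apply_one_tmul_of_mem_localNoriPoints
    {l : ∀ X : LocalTriple k K p, (R ⊗[k] X.W) ≃ₗ[R] (R ⊗[k] X.W)}
    (hl : l ∈ localNoriPoints k K p R) {X : LocalTriple k K p} {v : X.V} {w : X.W}
    (h : X.ψ (1 ⊗ₜ v) = 1 ⊗ₜ w) : l X (1 ⊗ₜ w) = 1 ⊗ₜ w := by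
  obtain ⟨natural, -, unit_eq_one⟩ := hl
  have hb : (LocalTriple.homOfUnit h).b.baseChange R ((1 : R) ⊗ₜ[k] (1 : k)) = 1 ⊗ₜ w :=
    congrArg (1 ⊗ₜ[k] ·) (one_smul k w)
  have := natural _ X (LocalTriple.homOfUnit h) (1 ⊗ₜ (1 : k))
  rw [unit_eq_one] at this
  exact (congrArg (l X) hb).symm.trans (this.symm.trans hb)

theorem localNoriPoints_eq_bot
    (h : Function.Surjective (algebraMap K (PerfectClosure K p))) :
    localNoriPoints k K p R = ⊥ := by
  refine (Subgroup.eq_bot_iff_forall _).2 fun l hl => funext fun X =>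
    LinearEquiv.toLinearMap_injective (linearMap_ext_one_tmul fun w => ?_)
  obtain ⟨v, hv⟩ := TensorProduct.mk_surjective K X.V _ h (X.ψ.symm (1 ⊗ₜ w))
  exact apply_one_tmul_of_mem_localNoriPoints hl (X.ψ.eq_symm_apply.1 hv)

variable [Algebra K R] [IsScalarTower k K R]

/-- The `R`-point of `π^L(K/k)` attached to two `K`-algebra maps `f, g : K^perf → R`. -/
noncomputable def comparisonPoint (f g : PerfectClosure K p →ₐ[K] R) : localNoriPoints k K p R :=
  ⟨fun X => comparison f g X.ψ, by
    refine ⟨fun X Y h x => ?_, fun X Y z => ?_, ?_⟩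
    · exact baseChange_comparison f g h.comm x
    · have comparison_tensor :
          comparison f g (X.tensor Y).ψ z = comparison f g (tensorIso X.ψ Y.ψ) z := rfl
      exact (congrArg _ comparison_tensor).trans
        (distribBaseChange_comparison_tensorIso f g X.ψ Y.ψ z)
    · exact comparison_unitIso f g⟩

theorem eq_of_comparisonPoint_eq_one {f g : PerfectClosure K p →ₐ[K] R}
    (h : comparisonPoint (k := k) f g = 1) : f = g := by
  ext t
  obtain rfl | ht := eq_or_ne t 0
  · rw [map_zero, map_zero]
  let y : R ⊗[k] k := 1 ⊗ₜ 1
  have twist_eq_one :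
      comparison f g (unitIso k K (PerfectClosure K p) ≪≫ₗ LinearEquiv.smulOfUnit (.mk0 t ht)) =
        1 :=
    congrFun (congrArg Subtype.val h) ((LocalTriple.unit k K p).twist (.mk0 t ht))
  have smul_eq : f t • y = g t • y := by
    simpa only [twist_eq_one, comparison_unitIso, LinearEquiv.coe_one, id_eq, Units.val_mk0] using
      comparison_smulOfUnit f g (unitIso k K (PerfectClosure K p)) (.mk0 t ht) y
  simpa [y] using congrArg (TensorProduct.AlgebraTensorModule.rid k R R) smul_eq

end LocalNori

theorem mainTheorem4_general (p : ℕ) [Fact p.Prime] (k : Type u) (K : Type v) [Field k] [Field K]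
    [Algebra k K] [CharP K p] :
    PerfectField K ↔
      ∀ R : CommAlgCat.{max u v} k, Subsingleton ((localNoriGroup k K p).obj R) := by
  rw [perfectField_iff_surjective_algebraMap_perfectClosure (p := p)]
  constructor
  · intro h R
    change Subsingleton (localNoriPoints k K p R)
    rw [localNoriPoints_eq_bot h]
    infer_instance
  · intro h
    let E := PerfectClosure K p
    -- The test ring must live in `Type (max u v)`, whereas `E ⊗[K] E` lives in `Type v`.
    let e : E ⊗[K] E ≃ₐ[K] ULift.{u} (E ⊗[K] E) := ULift.algEquiv.symm
    have points_subsingleton : Subsingleton (localNoriPoints k K p (ULift.{u} (E ⊗[K] E))) :=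
      h (CommAlgCat.of k _)
    have comp_eq : e.toAlgHom.comp Algebra.TensorProduct.includeLeft =
        e.toAlgHom.comp Algebra.TensorProduct.includeRight :=
      eq_of_comparisonPoint_eq_one (k := k) (Subsingleton.elim _ _)
    exact surjective_algebraMap_of_includeLeft_eq_includeRight
      ((AlgHom.cancel_left e.injective).1 comp_eq)

theorem mainTheorem4 (p : ℕ) [Fact p.Prime] (k : Type u) (K : Type v) [Field k] [Field K]
    [Algebra k K] [CharP k p] [CharP K p] [PerfectField k] :
    PerfectField K ↔
      ∀ R : CommAlgCat.{max u v} k, Subsingleton ((localNoriGroup k K p).obj R) :=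
  mainTheorem4_general p k K
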